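/- Let $K$ be a (not necessarily commutative) field contained in a ring $R$ with $1_K=1_R\ne 0$. The points of the chain geometry $\Sigma(K,R)$ are the cyclic submodules $R(1,0)^\gamma$, $\gamma\in GL_2(R)$, of the free left module $R^2$, on which $GL_2(R)$ acts from the right; its chains are the images under $GL_2(R)$ of the standard chain $\{R(k,l)\mid (k,l)\in K^2\setminus\{(0,0)\}\}$. An isomorphism of chain geometries is a bijection between the point sets that maps the set of chains onto the set of chains. Two points are distant if they are different and lie on a common chain. A set $U$ of points is a subspace if, with any three pairwise distant points, it contains every chain through them; $U$ is then endowed with all the chains that are contained in $U$. An algebra $S\neq 0$ (associative, with $1$) over a commutative field $L$ (identified with $L\cdot 1_S\subseteq S$) is called strong if for every $a\in S$ there are at least two elements $k\in L$ such that $a+k$ is a unit of $S$. Let $K=GF(4)$ be embedded as a subfield, with the same $1$, into the ring $R=M(2\times 2,GF(2))$. Then: (a) $\Sigma(K,R)$ is not isomorphic to $\Sigma(L,S)$ for any commutative field $L$ and any $L$-algebra $S\ne 0$. (b) For any commutative field $L$ and any strong $L$-algebra $S$, $\Sigma(K,R)$ is not isomorphic to any subspace of $\Sigma(L,S)$ (with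 the induced chains); that is, $\Sigma(K,R)$ cannot be embedded into $\Sigma(L,S)$ as a subspace. -/

import Mathlib

/-- A set of points together with a set of distinguished subsets, the chains. -/
structure ChainStructure where
  /-- the points -/
  Point : Type*
  /-- the chains -/
  chains : Set (Set Point)

namespace ChainStructure

/-- Two points are distant if they are different and joined by at least one chain. -/
def Distant (A : ChainStructure) (p q : A.Point) : Prop :=
  p ≠ q ∧ ∃ C ∈ A.chains, p ∈ C ∧ q ∈ C

/-- An isomorphism is a bijection of the points that maps the chains of `A`
exactly to the chains of `B`. -/
structure Iso (A B : ChainStructure) where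
  /-- the bijection of the points -/
  toEquiv : A.Point ≃ B.Point
  map_chains : ∀ C : Set A.Point, toEquiv '' C ∈ B.chains ↔ C ∈ A.chains

/-- The structure induced on a set `U` of points: its chains are the chains contained in `U`. -/
def induced (A : ChainStructure) (U : Set A.Point) : ChainStructure where
  Point := U
  chains := {C | (Subtype.val '' C : Set A.Point) ∈ A.chains}

/-- A set `U` of points is a subspace if it contains, with any three pairwise distant points,
each chain through them. -/
def IsSubspace (A : ChainStructure) (U : Set A.Point) : Prop :=
  ∀ p ∈ U, ∀ q ∈ U, ∀ r ∈ U, A.Distant p q → A.Distant p r → A.Distant q r →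
    ∀ C ∈ A.chains, p ∈ C → q ∈ C → r ∈ C → C ⊆ U

/-- `B` can be embedded into `A` as a subspace. -/
def EmbedsAsSubspace (B A : ChainStructure) : Prop :=
  ∃ U : Set A.Point, A.IsSubspace U ∧ Nonempty (Iso B (A.induced U))

end ChainStructure

/-- The (right) action of `γ ∈ GL₂(R)` on the submodules of the left `R`-module `R²`,
induced by `v ↦ v γ` on row vectors. -/
def glAct {R : Type*} [Ring R] (γ : (Matrix (Fin 2) (Fin 2) R)ˣ)
    (p : Submodule R (Fin 2 → R)) : Submodule R (Fin 2 → R) :=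
  p.map (Matrix.vecMulLinear (γ : Matrix (Fin 2) (Fin 2) R))

/-- The cyclic submodule `R(a,b)` of the left module `R²`. -/
def cyclicSubmodule {R : Type*} [Ring R] (a b : R) : Submodule R (Fin 2 → R) :=
  Submodule.span R {![a, b]}

/-- The projective line over `R`: the orbit of `R(1,0)` under `GL₂(R)`. -/
def projectiveLine (R : Type*) [Ring R] : Set (Submodule R (Fin 2 → R)) :=
  {p | ∃ γ : (Matrix (Fin 2) (Fin 2) R)ˣ, p = glAct γ (cyclicSubmodule 1 0)}

/-- The standard chain: the projective line over the (skew) field `K`, embedded into the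
projective line over `R` via `K(k,l) ↦ R(k,l)`. -/
def standardChain {K R : Type*} [DivisionRing K] [Ring R] (i : K →+* R) :
    Set (Submodule R (Fin 2 → R)) :=
  {p | ∃ k l : K, (k ≠ 0 ∨ l ≠ 0) ∧ p = cyclicSubmodule (i k) (i l)}

/-- The chain geometry `Σ(K,R)` over a ring `R ≠ 0` with a distinguished (skew) subfield `K`,
given by its inclusion `i` (not necessarily central). The chains are the images of the
standard chain under `GL₂(R)`. -/
def chainGeometry {K R : Type*} [DivisionRing K] [Ring R] (i : K →+* R) : ChainStructure where
  Point := projectiveLine R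
  chains := {C | ∃ γ : (Matrix (Fin 2) (Fin 2) R)ˣ,
    (Subtype.val '' C : Set (Submodule R (Fin 2 → R))) = glAct γ '' standardChain i}

/-- An `L`-algebra `S` is strong if for each `a ∈ S` there are at least two scalars `k ∈ L`
such that `a + k` is a unit of `S`. -/
def IsStrongAlgebra (L S : Type*) [Field L] [Ring S] [Algebra L S] : Prop :=
  ∀ a : S, ∃ k l : L, k ≠ l ∧ IsUnit (a + algebraMap L S k) ∧ IsUnit (a + algebraMap L S l)

/-! The two kinds of geometry are separated by crosses: two chains through points `p`, `q` such that
no chain through `p` meets both of them elsewhere. Isomorphisms preserve crosses.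

The unit group of `M(2×2,GF(2))` is the symmetric group on three letters, and `GF(4)*` is its normal
subgroup of order 3. Hence exactly two chains join `∞` and `0`, namely `K ∪ {∞}` and `K·flip ∪ {∞}`.
Points on a common chain through `∞` differ by a unit, but units from different cosets of `GF(4)*`
differ by a singular matrix. So the two chains form a cross (`exists_isCross`); each chain has 5
points.

In `Σ(L,S)` two chains through `p` and `q` become `L ∪ {∞}` and `Lu ∪ {∞}`. If `u + k` is a unit for
some `k ≠ 0`, the line joining `-k` and `u` is a chain that destroys the cross. In a strong algebra
such a `k` exists, and a subspace contains the destroying chain, whence (b). For (a), if there are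
only two joining chains, then `u² = c` lies in `L`. As `(u + a)(u - a) = c - a²` cannot be a unit,
`a² = c` for every `a ≠ 0`. So `L` has at most 3 elements and its chains at most 4 points, fewer
than 5 (`encard_le_of_isCross`). -/

namespace ChainGeometry

/-! ### Cyclic submodules, the action of the linear group, and affine coordinates -/

section General

variable {K R : Type*} [DivisionRing K] [Ring R]

/-- The point `R(1,x)` of the affine part of the projective line. -/
def affinePoint (x : R) : Submodule R (Fin 2 → R) := cyclicSubmodule 1 x

/-- The point `R(0,1)` at infinity. -/
def infPoint (R : Type*) [Ring R] : Submodule R (Fin 2 → R) := cyclicSubmodule 0 1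

/-- The line `c + Ku` of the affine part, together with the point at infinity. -/
def affineChain (i : K →+* R) (c u : R) : Set (Submodule R (Fin 2 → R)) :=
  insert (infPoint R) (Set.range fun k => affinePoint (c + i k * u))

/-- The chains of `Σ(K,R)` as sets of submodules. -/
def chainSets (i : K →+* R) : Set (Set (Submodule R (Fin 2 → R))) :=
  {C | ∃ γ : (Matrix (Fin 2) (Fin 2) R)ˣ, C = glAct γ '' standardChain i}

theorem mem_cyclicSubmodule {a b : R} {v : Fin 2 → R} :
    v ∈ cyclicSubmodule a b ↔ ∃ r, v 0 = r * a ∧ v 1 = r * b := by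
  rw [cyclicSubmodule, Submodule.mem_span_singleton]
  constructor
  · rintro ⟨r, rfl⟩
    exact ⟨r, by simp, by simp⟩
  · rintro ⟨r, h0, h1⟩
    refine ⟨r, ?_⟩
    ext j
    fin_cases j
    · simpa using h0.symm
    · simpa using h1.symm

theorem exists_of_cyclicSubmodule_eq {a b c d : R}
    (h : cyclicSubmodule a b = cyclicSubmodule c d) : ∃ r, a = r * c ∧ b = r * d := by
  have h1 : ![a, b] ∈ cyclicSubmodule c d := h ▸ mem_cyclicSubmodule.2 ⟨1, by simp, by simp⟩
  simpa using mem_cyclicSubmodule.1 h1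

theorem cyclicSubmodule_units_mul (r : Rˣ) (a b : R) :
    cyclicSubmodule (r * a) (r * b) = cyclicSubmodule a b := by
  ext v
  rw [mem_cyclicSubmodule, mem_cyclicSubmodule]
  constructor
  · rintro ⟨s, h0, h1⟩
    exact ⟨s * r, by rw [h0, mul_assoc], by rw [h1, mul_assoc]⟩
  · rintro ⟨s, h0, h1⟩
    exact ⟨s * ↑r⁻¹, by simp [h0, mul_assoc], by simp [h1, mul_assoc]⟩

theorem glAct_cyclicSubmodule (γ : (Matrix (Fin 2) (Fin 2) R)ˣ) (a b : R) :
    glAct γ (cyclicSubmodule a b) =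
      cyclicSubmodule (a * γ.1 0 0 + b * γ.1 1 0) (a * γ.1 0 1 + b * γ.1 1 1) := by
  rw [glAct, cyclicSubmodule, Submodule.map_span, Set.image_singleton, cyclicSubmodule]
  congr 2
  ext j
  fin_cases j <;> simp [Matrix.vecMul, dotProduct, Fin.sum_univ_two]

theorem glAct_mul (γ δ : (Matrix (Fin 2) (Fin 2) R)ˣ) (p : Submodule R (Fin 2 → R)) :
    glAct (γ * δ) p = glAct δ (glAct γ p) := by
  rw [glAct, glAct, glAct, ← Submodule.map_comp]
  congr 1
  refine LinearMap.ext fun v => ?_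
  simp [Matrix.vecMul_vecMul]

@[simp]
theorem glAct_one (p : Submodule R (Fin 2 → R)) : glAct 1 p = p := by
  have : Matrix.vecMulLinear (1 : Matrix (Fin 2) (Fin 2) R) = LinearMap.id :=
    LinearMap.ext fun v => by simp
  rw [glAct, Units.val_one, this, Submodule.map_id]

@[simp]
theorem glAct_inv_glAct (γ : (Matrix (Fin 2) (Fin 2) R)ˣ) (p : Submodule R (Fin 2 → R)) :
    glAct γ⁻¹ (glAct γ p) = p := by
  rw [← glAct_mul, mul_inv_cancel, glAct_one]

@[simp]
theorem glAct_glAct_inv (γ : (Matrix (Fin 2) (Fin 2) R)ˣ) (p : Submodule R (Fin 2 → R)) :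
    glAct γ (glAct γ⁻¹ p) = p := by
  rw [← glAct_mul, inv_mul_cancel, glAct_one]

theorem glAct_injective (γ : (Matrix (Fin 2) (Fin 2) R)ˣ) : Function.Injective (glAct γ) :=
  Function.LeftInverse.injective (glAct_inv_glAct γ)

theorem glAct_mul_image (γ δ : (Matrix (Fin 2) (Fin 2) R)ˣ)
    (C : Set (Submodule R (Fin 2 → R))) : glAct (γ * δ) '' C = glAct δ '' (glAct γ '' C) := by
  rw [Set.image_image]
  exact Set.image_congr fun p _ => glAct_mul γ δ p

theorem chainSets_image {i : K →+* R} (γ : (Matrix (Fin 2) (Fin 2) R)ˣ)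
    {C : Set (Submodule R (Fin 2 → R))} (hC : C ∈ chainSets i) : glAct γ '' C ∈ chainSets i := by
  obtain ⟨δ, rfl⟩ := hC
  exact ⟨δ * γ, (glAct_mul_image δ γ _).symm⟩

theorem affinePoint_injective : Function.Injective (affinePoint (R := R)) := by
  intro x y h
  obtain ⟨r, h0, h1⟩ := exists_of_cyclicSubmodule_eq h
  rw [mul_one] at h0
  rw [h1, ← h0, one_mul]

theorem affinePoint_ne_infPoint [Nontrivial R] (x : R) : affinePoint x ≠ infPoint R := by
  intro h
  obtain ⟨r, h0, -⟩ := exists_of_cyclicSubmodule_eq h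
  simp at h0

theorem infPoint_mem_affineChain (i : K →+* R) (c u : R) : infPoint R ∈ affineChain i c u :=
  Set.mem_insert _ _

theorem affinePoint_mem_affineChain [Nontrivial R] {i : K →+* R} {c u x : R} :
    affinePoint x ∈ affineChain i c u ↔ ∃ k, x = c + i k * u := by
  constructor
  · rintro (h | ⟨k, h⟩)
    · exact absurd h (affinePoint_ne_infPoint x)
    · exact ⟨k, (affinePoint_injective h).symm⟩
  · rintro ⟨k, rfl⟩
    exact Or.inr ⟨k, rfl⟩

theorem standardChain_eq (i : K →+* R) : standardChain i = affineChain i 0 1 := by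
  ext p
  constructor
  · rintro ⟨k, l, hkl, rfl⟩
    by_cases hk : k = 0
    · subst hk
      have hl : l ≠ 0 := by simpa using hkl
      left
      have := cyclicSubmodule_units_mul (Units.map i.toMonoidHom (Units.mk0 l hl)) 0 1
      simpa [infPoint] using this
    · right
      refine ⟨k⁻¹ * l, ?_⟩
      have := cyclicSubmodule_units_mul (Units.map i.toMonoidHom (Units.mk0 k hk)) 1 (i (k⁻¹ * l))
      simp only [Units.coe_map, Units.val_mk0, RingHom.toMonoidHom_eq_coe, MonoidHom.coe_coe,
        mul_one, ← map_mul, mul_inv_cancel_left₀ hk] at this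
      simp [affinePoint, this]
  · rintro (rfl | ⟨k, rfl⟩)
    · exact ⟨0, 1, by simp, by simp [infPoint]⟩
    · exact ⟨1, k, by simp, by simp [affinePoint]⟩

/-! ### Elementary projectivities and the stabilizer of the standard chain -/

/-- The translation `x ↦ x + c` of the affine part. -/
def translation (c : R) : (Matrix (Fin 2) (Fin 2) R)ˣ where
  val := !![1, c; 0, 1]
  inv := !![1, -c; 0, 1]
  val_inv := by simp [Matrix.one_fin_two]
  inv_val := by simp [Matrix.one_fin_two]

/-- The scaling `x ↦ x u` of the affine part. -/
def scaling (u : Rˣ) : (Matrix (Fin 2) (Fin 2) R)ˣ where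
  val := !![1, 0; 0, ↑u]
  inv := !![1, 0; 0, ↑u⁻¹]
  val_inv := by simp [Matrix.one_fin_two]
  inv_val := by simp [Matrix.one_fin_two]

/-- The exchange of the two coordinates. -/
def coordSwap (R : Type*) [Ring R] : (Matrix (Fin 2) (Fin 2) R)ˣ where
  val := !![0, 1; 1, 0]
  inv := !![0, 1; 1, 0]
  val_inv := by simp [Matrix.one_fin_two]
  inv_val := by simp [Matrix.one_fin_two]

@[simp]
theorem glAct_translation_affinePoint (c x : R) :
    glAct (translation c) (affinePoint x) = affinePoint (c + x) := by
  simp [affinePoint, glAct_cyclicSubmodule, translation]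

@[simp]
theorem glAct_translation_infPoint (c : R) :
    glAct (translation c) (infPoint R) = infPoint R := by
  simp [infPoint, glAct_cyclicSubmodule, translation]

@[simp]
theorem glAct_scaling_affinePoint (u : Rˣ) (x : R) :
    glAct (scaling u) (affinePoint x) = affinePoint (x * u) := by
  simp [affinePoint, glAct_cyclicSubmodule, scaling]

@[simp]
theorem glAct_scaling_infPoint (u : Rˣ) : glAct (scaling u) (infPoint R) = infPoint R := by
  have := cyclicSubmodule_units_mul u 0 1
  simp only [mul_zero, mul_one] at this
  simp [infPoint, glAct_cyclicSubmodule, scaling, this]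

theorem glAct_coordSwap_cyclicSubmodule (a b : R) :
    glAct (coordSwap R) (cyclicSubmodule a b) = cyclicSubmodule b a := by
  simp [glAct_cyclicSubmodule, coordSwap]

theorem glAct_translation_affineChain (i : K →+* R) (d c u : R) :
    glAct (translation d) '' affineChain i c u = affineChain i (d + c) u := by
  rw [affineChain, Set.image_insert_eq, ← Set.range_comp, glAct_translation_infPoint, affineChain]
  congr 2
  ext1 k
  simp [add_assoc]

theorem glAct_scaling_affineChain (i : K →+* R) (u : Rˣ) :
    glAct (scaling u) '' affineChain i 0 1 = affineChain i 0 u := by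
  rw [affineChain, Set.image_insert_eq, ← Set.range_comp, glAct_scaling_infPoint, affineChain]
  congr 2
  ext1 k
  simp

theorem affineChain_mem_chainSets (i : K →+* R) (c : R) (u : Rˣ) :
    affineChain i c u ∈ chainSets i := by
  have h : affineChain i c u = glAct (translation c) '' (glAct (scaling u) '' standardChain i) := by
    rw [standardChain_eq, glAct_scaling_affineChain, glAct_translation_affineChain, add_zero]
  rw [h]
  exact chainSets_image _ (chainSets_image _ ⟨1, by simp⟩)

theorem glAct_coordSwap_standardChain (i : K →+* R) :
    glAct (coordSwap R) '' standardChain i = standardChain i := by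
  have h : ∀ p ∈ standardChain i, glAct (coordSwap R) p ∈ standardChain i := by
    rintro _ ⟨k, l, hkl, rfl⟩
    exact ⟨l, k, hkl.symm, glAct_coordSwap_cyclicSubmodule _ _⟩
  apply Set.Subset.antisymm
  · rintro _ ⟨p, hp, rfl⟩
    exact h p hp
  · rintro _ ⟨k, l, hkl, rfl⟩
    exact ⟨_, ⟨l, k, hkl.symm, rfl⟩, glAct_coordSwap_cyclicSubmodule _ _⟩

theorem glAct_translation_standardChain (i : K →+* R) (k : K) :
    glAct (translation (i k)) '' standardChain i = standardChain i := by
  rw [standardChain_eq, glAct_translation_affineChain, affineChain, affineChain]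
  congr 1
  ext p
  constructor
  · rintro ⟨l, rfl⟩
    exact ⟨k + l, by simp⟩
  · rintro ⟨l, rfl⟩
    exact ⟨-k + l, by simp⟩

/-- The stabilizer of the standard chain acts doubly transitively on it. -/
theorem exists_stabilizer_standardChain [Nontrivial R] (i : K →+* R)
    {p q : Submodule R (Fin 2 → R)} (hp : p ∈ standardChain i) (hq : q ∈ standardChain i)
    (hpq : p ≠ q) : ∃ γ : (Matrix (Fin 2) (Fin 2) R)ˣ, glAct γ '' standardChain i =
      standardChain i ∧ glAct γ (infPoint R) = p ∧ glAct γ (affinePoint 0) = q := by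
  have inf_case : ∀ q ∈ standardChain i, infPoint R ≠ q →
      ∃ γ : (Matrix (Fin 2) (Fin 2) R)ˣ, glAct γ '' standardChain i =
      standardChain i ∧ glAct γ (infPoint R) = infPoint R ∧ glAct γ (affinePoint 0) = q := by
    intro q hq hne
    rw [standardChain_eq] at hq
    rcases hq with rfl | ⟨k, rfl⟩
    · exact absurd rfl hne
    · exact ⟨translation (i k), glAct_translation_standardChain i k, by simp, by simp⟩
  have hp' := hp
  rw [standardChain_eq] at hp'
  rcases hp' with rfl | ⟨k, rfl⟩
  · exact inf_case q hq hpq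
  -- The swap followed by a translation preserves the standard chain and takes `∞` to the given
  -- affine point, which reduces to the case `p = ∞`.
  · let δ := coordSwap R * translation (i k)
    have hδ : glAct δ '' standardChain i = standardChain i := by
      rw [glAct_mul_image, glAct_coordSwap_standardChain, glAct_translation_standardChain]
    have hinf : glAct δ (infPoint R) = affinePoint (i k) := by
      have : glAct (coordSwap R) (infPoint R) = affinePoint 0 :=
        glAct_coordSwap_cyclicSubmodule _ _
      rw [glAct_mul, this, glAct_translation_affinePoint, add_zero]
    rw [← hδ] at hq
    obtain ⟨q', hq', rfl⟩ := hq
    have hne : infPoint R ≠ q' := by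
      rintro rfl
      exact hpq (by simp [hinf])
    obtain ⟨γ, h1, h2, h3⟩ := inf_case q' hq' hne
    exact ⟨γ * δ, by rw [glAct_mul_image, h1, hδ], by simp [glAct_mul, h2, hinf],
      by simp [glAct_mul, h3]⟩

/-- Every chain with two distinguished points is the image of the standard one. -/
theorem exists_glAct_standardChain [Nontrivial R] (i : K →+* R)
    {C : Set (Submodule R (Fin 2 → R))} (hC : C ∈ chainSets i)
    {p q : Submodule R (Fin 2 → R)} (hp : p ∈ C) (hq : q ∈ C) (hpq : p ≠ q) :
    ∃ γ : (Matrix (Fin 2) (Fin 2) R)ˣ, C = glAct γ '' standardChain i ∧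
      p = glAct γ (infPoint R) ∧ q = glAct γ (affinePoint 0) := by
  obtain ⟨γ, rfl⟩ := hC
  obtain ⟨p, hp, rfl⟩ := hp
  obtain ⟨q, hq, rfl⟩ := hq
  obtain ⟨δ, h1, h2, h3⟩ := exists_stabilizer_standardChain i hp hq fun h => hpq (h ▸ rfl)
  exact ⟨δ * γ, by rw [glAct_mul_image, h1], by rw [glAct_mul, h2], by rw [glAct_mul, h3]⟩

/-! ### Chains through `∞` when the subfield is normalized by the units -/

theorem offDiag_eq_zero {γ : (Matrix (Fin 2) (Fin 2) R)ˣ}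
    (h1 : glAct γ (infPoint R) = infPoint R) (h0 : glAct γ (affinePoint 0) = affinePoint 0) :
    γ.1 1 0 = 0 ∧ γ.1 0 1 = 0 := by
  rw [infPoint, glAct_cyclicSubmodule] at h1
  rw [affinePoint, glAct_cyclicSubmodule] at h0
  obtain ⟨r, hr, -⟩ := exists_of_cyclicSubmodule_eq h1
  obtain ⟨s, -, hs⟩ := exists_of_cyclicSubmodule_eq h0
  exact ⟨by simpa using hr, by simpa using hs⟩

/-- The projectivities fixing `R(0,1)` and `R(1,0)` are given by invertible diagonal matrices. -/
theorem exists_units_of_fixes {γ : (Matrix (Fin 2) (Fin 2) R)ˣ}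
    (h1 : glAct γ (infPoint R) = infPoint R) (h0 : glAct γ (affinePoint 0) = affinePoint 0) :
    ∃ a b : Rˣ, γ.1 = !![(a : R), 0; 0, (b : R)] := by
  -- The inverse fixes the same two points, so it is diagonal too, and its diagonal entries invert
  -- those of `γ`.
  have h1' : glAct γ⁻¹ (infPoint R) = infPoint R := by
    conv_lhs => rw [← h1, glAct_inv_glAct]
  have h0' : glAct γ⁻¹ (affinePoint 0) = affinePoint 0 := by
    conv_lhs => rw [← h0, glAct_inv_glAct]
  obtain ⟨g10, g01⟩ := offDiag_eq_zero h1 h0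
  obtain ⟨d10, d01⟩ := offDiag_eq_zero h1' h0'
  have e1 := γ.mul_inv
  have e2 := γ.inv_mul
  have e1a := congrFun (congrFun e1 0) 0
  have e1b := congrFun (congrFun e1 1) 1
  have e2a := congrFun (congrFun e2 0) 0
  have e2b := congrFun (congrFun e2 1) 1
  rw [Matrix.mul_apply, Fin.sum_univ_two] at e1a e1b e2a e2b
  rw [d10, mul_zero, add_zero, Matrix.one_apply_eq] at e1a
  rw [d01, mul_zero, zero_add, Matrix.one_apply_eq] at e1b
  rw [g10, mul_zero, add_zero, Matrix.one_apply_eq] at e2a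
  rw [g01, mul_zero, zero_add, Matrix.one_apply_eq] at e2b
  refine ⟨⟨_, _, e1a, e2a⟩, ⟨_, _, e1b, e2b⟩, ?_⟩
  ext j k
  fin_cases j <;> fin_cases k <;> simp [g10, g01]

/-- The subfield is normalized by the group of units. -/
def IsNormalized (i : K →+* R) : Prop :=
  ∀ (a : Rˣ) (k : K), ∃ l : K, ↑a⁻¹ * i k * a = i l

/-- A projectivity fixing `∞` and `0` is `diag(a, b)` and takes `K` to `a⁻¹Kb`; normalization turns
this set into `K(a⁻¹b)`. -/
theorem eq_affineChain_zero [Nontrivial R] {i : K →+* R} (hi : IsNormalized i)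
    {C : Set (Submodule R (Fin 2 → R))} (hC : C ∈ chainSets i) (h1 : infPoint R ∈ C)
    (h0 : affinePoint 0 ∈ C) : ∃ u : Rˣ, C = affineChain i 0 u := by
  obtain ⟨γ, rfl, hinf, hzero⟩ := exists_glAct_standardChain i hC h1 h0
    (affinePoint_ne_infPoint 0).symm
  obtain ⟨a, b, hab⟩ := exists_units_of_fixes hinf.symm hzero.symm
  have hpt : ∀ x : R, glAct γ (affinePoint x) = affinePoint (↑a⁻¹ * x * b) := by
    intro x
    rw [affinePoint, affinePoint, glAct_cyclicSubmodule, hab, ← cyclicSubmodule_units_mul a⁻¹]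
    simp [mul_assoc]
  refine ⟨a⁻¹ * b, ?_⟩
  rw [standardChain_eq, affineChain, Set.image_insert_eq, ← Set.range_comp, ← hinf, affineChain]
  congr 1
  ext p
  constructor
  · rintro ⟨k, rfl⟩
    obtain ⟨l, hl⟩ := hi a k
    refine ⟨l, ?_⟩
    simp [hpt, ← hl, mul_assoc]
  · rintro ⟨k, rfl⟩
    obtain ⟨l, hl⟩ := hi a⁻¹ k
    refine ⟨l, ?_⟩
    simp [hpt, ← hl, mul_assoc]

theorem eq_affineChain [Nontrivial R] {i : K →+* R} (hi : IsNormalized i)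
    {C : Set (Submodule R (Fin 2 → R))} (hC : C ∈ chainSets i) (h1 : infPoint R ∈ C) {c : R}
    (hc : affinePoint c ∈ C) : ∃ u : Rˣ, C = affineChain i c u := by
  obtain ⟨u, hu⟩ := eq_affineChain_zero hi (chainSets_image (translation (-c)) hC)
    ⟨_, h1, by simp⟩ ⟨_, hc, by simp⟩
  refine ⟨u, ?_⟩
  have := congrArg (glAct (translation c) '' ·) hu
  simp only [glAct_translation_affineChain, add_zero] at this
  rw [← this, Set.image_image]
  have hid : ∀ p ∈ C, glAct (translation c) (glAct (translation (-c)) p) = p := by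
    intro p _
    have : translation (-c) = (translation c)⁻¹ := Units.ext (by rfl)
    rw [this, glAct_glAct_inv]
  rw [Set.image_congr hid, Set.image_id']

/-- Two points of a line `x + Ku` differ by a nonzero element of `K` times the unit `u`. -/
theorem isUnit_sub_of_mem_chain [Nontrivial R] {i : K →+* R} (hi : IsNormalized i)
    {C : Set (Submodule R (Fin 2 → R))} (hC : C ∈ chainSets i) (h1 : infPoint R ∈ C) {x y : R}
    (hx : affinePoint x ∈ C) (hy : affinePoint y ∈ C) (hxy : x ≠ y) : IsUnit (y - x) := by
  obtain ⟨u, rfl⟩ := eq_affineChain hi hC h1 hx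
  obtain ⟨k, rfl⟩ := affinePoint_mem_affineChain.1 hy
  have hk : k ≠ 0 := by
    rintro rfl
    simp at hxy
  rw [add_sub_cancel_left]
  exact ((IsUnit.mk0 k hk).map i).mul u.isUnit

theorem mem_projectiveLine_of_mem_chainSets {i : K →+* R} {C : Set (Submodule R (Fin 2 → R))}
    (hC : C ∈ chainSets i) : C ⊆ projectiveLine R := by
  obtain ⟨γ, rfl⟩ := hC
  rw [standardChain_eq]
  have hpt : ∀ x : R, affinePoint x = glAct (translation x) (cyclicSubmodule 1 0) := fun x => by
    have := glAct_translation_affinePoint x 0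
    rw [add_zero] at this
    exact this.symm
  rintro _ ⟨p, rfl | ⟨k, rfl⟩, rfl⟩
  · exact ⟨coordSwap R * γ, by rw [glAct_mul, glAct_coordSwap_cyclicSubmodule]; rfl⟩
  · exact ⟨translation _ * γ, by rw [glAct_mul, ← hpt]⟩

/-- The submodule underlying a point of the chain geometry. -/
def pointVal (i : K →+* R) : (chainGeometry i).Point → Submodule R (Fin 2 → R) := Subtype.val

theorem pointVal_injective (i : K →+* R) : Function.Injective (pointVal i) :=
  Subtype.val_injective

theorem mem_chains_iff {i : K →+* R} {C : Set (chainGeometry i).Point} :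
    C ∈ (chainGeometry i).chains ↔ pointVal i '' C ∈ chainSets i := Iff.rfl

theorem range_pointVal (i : K →+* R) : Set.range (pointVal i) = projectiveLine R :=
  Subtype.range_val

/-- A set of submodules that is a chain comes from a chain of the geometry. -/
theorem exists_chain {i : K →+* R} {C : Set (Submodule R (Fin 2 → R))} (hC : C ∈ chainSets i) :
    ∃ D ∈ (chainGeometry i).chains, pointVal i '' D = C := by
  have h : pointVal i '' (pointVal i ⁻¹' C) = C := by
    apply Set.image_preimage_eq_of_subset
    rw [range_pointVal]
    exact mem_projectiveLine_of_mem_chainSets hC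
  exact ⟨pointVal i ⁻¹' C, mem_chains_iff.2 (by rw [h]; exact hC), h⟩

theorem exists_mem_of_affinePoint_mem {i : K →+* R} {C : Set (chainGeometry i).Point}
    {γ : (Matrix (Fin 2) (Fin 2) R)ˣ} {c u x : R}
    (hC : pointVal i '' C = glAct γ '' affineChain i c u)
    (hx : affinePoint x ∈ affineChain i c u) :
    ∃ z ∈ C, pointVal i z = glAct γ (affinePoint x) := by
  have := Set.mem_image_of_mem (glAct γ) hx
  rwa [← hC] at this

theorem mem_of_pointVal_eq {i : K →+* R} {C : Set (chainGeometry i).Point}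
    {γ : (Matrix (Fin 2) (Fin 2) R)ˣ} {P : Set (Submodule R (Fin 2 → R))}
    (hC : pointVal i '' C = glAct γ '' P) {z : (chainGeometry i).Point}
    {r : Submodule R (Fin 2 → R)} (hz : pointVal i z = glAct γ r) (hr : r ∈ P) : z ∈ C := by
  rw [← (pointVal_injective i).mem_set_image, hC, hz]
  exact Set.mem_image_of_mem _ hr

end General

/-! ### Crosses and their invariance under isomorphisms -/

section Cross

/-- Two chains through `p` and `q` such that no chain through `p` meets both of them in points
other than `p` and `q`. -/
structure IsCross (A : ChainStructure) (p q : A.Point) (C₁ C₂ : Set A.Point) : Prop where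
  ne : p ≠ q
  left_chain : C₁ ∈ A.chains
  right_chain : C₂ ∈ A.chains
  mem_left : p ∈ C₁ ∧ q ∈ C₁
  mem_right : p ∈ C₂ ∧ q ∈ C₂
  separated : ∀ D ∈ A.chains, p ∈ D → ∀ x ∈ C₁, x ≠ p → x ≠ q → x ∈ D →
    ∀ y ∈ C₂, y ≠ p → y ≠ q → y ∉ D

theorem IsCross.map {A B : ChainStructure} (f : ChainStructure.Iso A B) {p q : A.Point}
    {C₁ C₂ : Set A.Point} (h : IsCross A p q C₁ C₂) :
    IsCross B (f.toEquiv p) (f.toEquiv q) (f.toEquiv '' C₁) (f.toEquiv '' C₂) where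
  ne := f.toEquiv.injective.ne h.ne
  left_chain := (f.map_chains _).2 h.left_chain
  right_chain := (f.map_chains _).2 h.right_chain
  mem_left := ⟨Set.mem_image_of_mem _ h.mem_left.1, Set.mem_image_of_mem _ h.mem_left.2⟩
  mem_right := ⟨Set.mem_image_of_mem _ h.mem_right.1, Set.mem_image_of_mem _ h.mem_right.2⟩
  separated := by
    intro D hD hp
    obtain ⟨D, rfl⟩ := f.toEquiv.surjective.image_surjective D
    rw [f.map_chains] at hD
    rw [f.toEquiv.injective.mem_set_image] at hp
    rintro _ ⟨x, hx, rfl⟩ hxp hxq hxD _ ⟨y, hy, rfl⟩ hyp hyq hyD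
    rw [f.toEquiv.injective.mem_set_image] at hxD hyD
    rw [f.toEquiv.injective.ne_iff] at hxp hxq hyp hyq
    exact h.separated D hD hp x hx hxp hxq hxD y hy hyp hyq hyD

end Cross

/-! ### Crosses in the chain geometry of an algebra -/

section Algebra

variable {L S : Type*} [Field L] [Ring S] [Algebra L S]

theorem isNormalized_algebraMap : IsNormalized (algebraMap L S) := fun a k =>
  ⟨k, by rw [mul_assoc, Algebra.commutes, Units.inv_mul_cancel_left]⟩

variable [Nontrivial S]

/-- Two chains through two points can be moved to `L ∪ {∞}` and `Lu ∪ {∞}`. -/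
theorem exists_coordinates {p q : (chainGeometry (algebraMap L S)).Point}
    {C₁ C₂ : Set (chainGeometry (algebraMap L S)).Point} (hpq : p ≠ q)
    (h₁ : C₁ ∈ (chainGeometry (algebraMap L S)).chains) (hp₁ : p ∈ C₁) (hq₁ : q ∈ C₁)
    (h₂ : C₂ ∈ (chainGeometry (algebraMap L S)).chains) (hp₂ : p ∈ C₂) (hq₂ : q ∈ C₂) :
    ∃ (γ : (Matrix (Fin 2) (Fin 2) S)ˣ) (u : Sˣ),
      pointVal _ p = glAct γ (infPoint S) ∧ pointVal _ q = glAct γ (affinePoint 0) ∧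
      pointVal _ '' C₁ = glAct γ '' affineChain (algebraMap L S) 0 1 ∧
      pointVal _ '' C₂ = glAct γ '' affineChain (algebraMap L S) 0 u := by
  obtain ⟨γ, hC, hp, hq⟩ := exists_glAct_standardChain (algebraMap L S) (mem_chains_iff.1 h₁)
    (Set.mem_image_of_mem _ hp₁) (Set.mem_image_of_mem _ hq₁) ((pointVal_injective _).ne hpq)
  obtain ⟨u, hu⟩ := eq_affineChain_zero isNormalized_algebraMap
    (chainSets_image γ⁻¹ (mem_chains_iff.1 h₂))
    ⟨_, Set.mem_image_of_mem _ hp₂, by rw [hp, glAct_inv_glAct]⟩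
    ⟨_, Set.mem_image_of_mem _ hq₂, by rw [hq, glAct_inv_glAct]⟩
  refine ⟨γ, u, hp, hq, by rw [hC, standardChain_eq], ?_⟩
  rw [← hu, ← glAct_mul_image, inv_mul_cancel]
  simp

/-- If `u + k` is a unit for some scalar `k ≠ 0`, then the chains `L ∪ {∞}` and `Lu ∪ {∞}`
are met by a further chain through `∞`. -/
theorem exists_transversal_chain {p q : (chainGeometry (algebraMap L S)).Point}
    {C₁ C₂ : Set (chainGeometry (algebraMap L S)).Point}
    {γ : (Matrix (Fin 2) (Fin 2) S)ˣ} {u : Sˣ}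
    (hp : pointVal _ p = glAct γ (infPoint S)) (hq : pointVal _ q = glAct γ (affinePoint 0))
    (h₁ : pointVal _ '' C₁ = glAct γ '' affineChain (algebraMap L S) 0 1)
    (h₂ : pointVal _ '' C₂ = glAct γ '' affineChain (algebraMap L S) 0 u)
    {k : L} (hk : k ≠ 0) (huk : IsUnit (u + algebraMap L S k)) :
    ∃ D ∈ (chainGeometry (algebraMap L S)).chains, ∃ x ∈ C₁, ∃ y ∈ C₂,
      p ∈ D ∧ x ∈ D ∧ y ∈ D ∧ x ≠ y ∧ x ≠ p ∧ x ≠ q ∧ y ≠ p ∧ y ≠ q := by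
  obtain ⟨v, hv⟩ := huk
  -- The chain is the line `-k + L(u + k)`: the coefficients 0 and 1 give the points `-k` on `L` and
  -- `u` on `Lu`.
  obtain ⟨D, hD, hDv⟩ := exists_chain (chainSets_image γ
    (affineChain_mem_chainSets (algebraMap L S) (algebraMap L S (-k)) v))
  obtain ⟨x, hx, hxv⟩ := exists_mem_of_affinePoint_mem (x := algebraMap L S (-k)) h₁
    (affinePoint_mem_affineChain.2 ⟨-k, by simp⟩)
  obtain ⟨y, hy, hyv⟩ := exists_mem_of_affinePoint_mem (x := (u : S)) h₂
    (affinePoint_mem_affineChain.2 ⟨1, by simp⟩)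
  refine ⟨D, hD, x, hx, y, hy, mem_of_pointVal_eq hDv hp (infPoint_mem_affineChain _ _ _),
    mem_of_pointVal_eq hDv hxv (affinePoint_mem_affineChain.2 ⟨0, by simp⟩),
    mem_of_pointVal_eq hDv hyv (affinePoint_mem_affineChain.2 ⟨1, by simp [hv]⟩),
    ?_, ?_, ?_, ?_, ?_⟩
  · rintro rfl
    have h := affinePoint_injective (glAct_injective γ (hxv.symm.trans hyv))
    apply v.ne_zero
    rw [hv, ← h]
    simp
  · rintro rfl
    exact affinePoint_ne_infPoint _ (glAct_injective γ (hxv.symm.trans hp))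
  · rintro rfl
    have h := affinePoint_injective (glAct_injective γ (hxv.symm.trans hq))
    simp [hk] at h
  · rintro rfl
    exact affinePoint_ne_infPoint _ (glAct_injective γ (hyv.symm.trans hp))
  · rintro rfl
    exact u.ne_zero (affinePoint_injective (glAct_injective γ (hyv.symm.trans hq)))

/-- If the chains of a cross are the only chains joining its two points, then they have
at most four points. -/
theorem encard_le_of_isCross {p q : (chainGeometry (algebraMap L S)).Point}
    {C₁ C₂ : Set (chainGeometry (algebraMap L S)).Point}
    (h : IsCross (chainGeometry (algebraMap L S)) p q C₁ C₂)
    (honly : ∀ D ∈ (chainGeometry (algebraMap L S)).chains, p ∈ D → q ∈ D → D = C₁ ∨ D = C₂) :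
    C₁.encard ≤ 4 := by
  obtain ⟨γ, u, hp, hq, h₁, h₂⟩ := exists_coordinates h.ne h.left_chain h.mem_left.1 h.mem_left.2
    h.right_chain h.mem_right.1 h.mem_right.2
  have hnot : ∀ k : L, k ≠ 0 → ¬ IsUnit ((u : S) + algebraMap L S k) := by
    intro k hk huk
    obtain ⟨D, hD, x, hx, y, hy, hpD, hxD, hyD, -, hxp, hxq, hyp, hyq⟩ :=
      exists_transversal_chain hp hq h₁ h₂ hk huk
    exact h.separated D hD hpD x hx hxp hxq hxD y hy hyp hyq hyD
  -- Otherwise `u` is a third common point of both chains, and `C₁` itself violates separation with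
  -- `x = y`.
  have hscalar : ∀ k : L, (u : S) ≠ algebraMap L S k := by
    intro k hk
    obtain ⟨y, hy, hyv⟩ := exists_mem_of_affinePoint_mem (x := (u : S)) h₂
      (affinePoint_mem_affineChain.2 ⟨1, by simp⟩)
    have hyp : y ≠ p := by
      rintro rfl
      exact affinePoint_ne_infPoint _ (glAct_injective γ (hyv.symm.trans hp))
    have hyq : y ≠ q := by
      rintro rfl
      exact u.ne_zero (affinePoint_injective (glAct_injective γ (hyv.symm.trans hq)))
    have hy₁ : y ∈ C₁ :=
      mem_of_pointVal_eq h₁ hyv (affinePoint_mem_affineChain.2 ⟨k, by simp [hk]⟩)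
    exact h.separated C₁ h.left_chain h.mem_left.1 y hy₁ hyp hyq hy₁ y hy hyp hyq hy₁
  -- The chain `Lu² ∪ {∞}` joins `p` and `q`, so it is one of the two given chains. If it is the
  -- second, `u² = ku`, and cancelling `u` makes `u` a scalar.
  obtain ⟨c, hc⟩ : ∃ c : L, (u : S) * u = algebraMap L S c := by
    obtain ⟨D, hD, hDv⟩ := exists_chain (chainSets_image γ
      (affineChain_mem_chainSets (algebraMap L S) 0 (u * u)))
    have hmem : glAct γ (affinePoint ((u : S) * u)) ∈ pointVal _ '' D := by
      rw [hDv]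
      exact Set.mem_image_of_mem _ (affinePoint_mem_affineChain.2 ⟨1, by simp⟩)
    rcases honly D hD (mem_of_pointVal_eq hDv hp (infPoint_mem_affineChain _ _ _))
      (mem_of_pointVal_eq hDv hq (affinePoint_mem_affineChain.2 ⟨0, by simp⟩)) with rfl | rfl
    · rw [h₁, (glAct_injective γ).mem_set_image, affinePoint_mem_affineChain] at hmem
      simpa using hmem
    · rw [h₂, (glAct_injective γ).mem_set_image, affinePoint_mem_affineChain] at hmem
      obtain ⟨k, hk⟩ := hmem
      rw [zero_add] at hk
      exact absurd (u.mul_left_inj.1 hk) (hscalar k)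
  -- If `c - a²` were nonzero, the commuting factors `u + a` and `u - a` of this scalar would both
  -- be units.
  have hsq : ∀ a : L, a ≠ 0 → c = a * a := by
    intro a ha
    by_contra hne
    have hua : Commute (algebraMap L S a) (u : S) := Algebra.commutes a (u : S)
    have hcomm : Commute ((u : S) + algebraMap L S a) (u - algebraMap L S a) :=
      ((Commute.refl (u : S)).sub_right hua.symm).add_left (hua.sub_right (Commute.refl _))
    have hprod : ((u : S) + algebraMap L S a) * (u - algebraMap L S a) =
        algebraMap L S (c - a * a) := by
      rw [← hua.symm.mul_self_sub_mul_self_eq, hc, map_sub,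
        map_mul]
    have hunit : IsUnit (((u : S) + algebraMap L S a) * (u - algebraMap L S a)) := by
      rw [hprod]
      exact (IsUnit.mk0 _ (sub_ne_zero.2 hne)).map _
    exact hnot a ha (hcomm.isUnit_mul_iff.1 hunit).1
  have hc1 : c = 1 := by simpa using hsq 1 one_ne_zero
  -- Every nonzero scalar has square `c = 1`, hence is `1` or `-1`.
  have hsub : pointVal _ '' C₁ ⊆ glAct γ ''
      {infPoint S, affinePoint 0, affinePoint 1, affinePoint (-1)} := by
    rw [h₁]
    apply Set.image_mono
    rintro _ (rfl | ⟨k, rfl⟩)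
    · simp
    · by_cases hk : k = 0
      · simp [hk]
      · rcases mul_self_eq_one_iff.1 ((hsq k hk).symm.trans hc1) with rfl | rfl <;> simp
  calc C₁.encard = (pointVal _ '' C₁).encard := ((pointVal_injective _).encard_image _).symm
    _ ≤ _ := Set.encard_le_encard hsub
    _ ≤ _ := Set.encard_image_le _ _
    _ ≤ 4 := by
      have e1 := Set.encard_insert_le {affinePoint 0, affinePoint (1 : S), affinePoint (-1)}
        (infPoint S)
      have e2 := Set.encard_insert_le {affinePoint (1 : S), affinePoint (-1)} (affinePoint 0)
      have e3 := Set.encard_insert_le {affinePoint (-1 : S)} (affinePoint 1)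
      rw [Set.encard_singleton] at e3
      calc _ ≤ (1 + 1 + 1 + 1 : ℕ∞) := e1.trans (by gcongr; exact e2.trans (by gcongr))
        _ = 4 := by norm_num

/-- The chain geometry of a strong algebra has no subspace that contains a cross. -/
theorem not_isCross_induced (hS : IsStrongAlgebra L S)
    {U : Set (chainGeometry (algebraMap L S)).Point}
    (hU : (chainGeometry (algebraMap L S)).IsSubspace U)
    {p q : ((chainGeometry (algebraMap L S)).induced U).Point}
    {C₁ C₂ : Set ((chainGeometry (algebraMap L S)).induced U).Point} :
    ¬ IsCross ((chainGeometry (algebraMap L S)).induced U) p q C₁ C₂ := by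
  intro h
  let ι : ((chainGeometry (algebraMap L S)).induced U).Point →
    (chainGeometry (algebraMap L S)).Point := Subtype.val
  have hι : Function.Injective ι := Subtype.val_injective
  have hrange : Set.range ι = U := Subtype.range_val
  obtain ⟨γ, u, hp, hq, h₁, h₂⟩ := exists_coordinates (p := ι p) (q := ι q) (C₁ := ι '' C₁)
    (C₂ := ι '' C₂) (hι.ne h.ne) h.left_chain (Set.mem_image_of_mem _ h.mem_left.1)
    (Set.mem_image_of_mem _ h.mem_left.2) h.right_chain (Set.mem_image_of_mem _ h.mem_right.1)
    (Set.mem_image_of_mem _ h.mem_right.2)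
  -- The scalar 0 is useless here since `u` is already a unit; of two different scalars one is
  -- nonzero.
  obtain ⟨k, hk, huk⟩ : ∃ k : L, k ≠ 0 ∧ IsUnit ((u : S) + algebraMap L S k) := by
    obtain ⟨k, l, hkl, hk, hl⟩ := hS u
    by_cases hk0 : k = 0
    · exact ⟨l, fun hl0 => hkl (hk0.trans hl0.symm), hl⟩
    · exact ⟨k, hk0, hk⟩
  obtain ⟨D, hD, _, ⟨x, hx, rfl⟩, _, ⟨y, hy, rfl⟩, hpD, hxD, hyD, hxy, hxp, hxq, hyp, hyq⟩ :=
    exists_transversal_chain hp hq h₁ h₂ hk huk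
  -- The points `p`, `x`, `y` of `U` are pairwise distant because `D` joins them, so `D` is also a
  -- chain of the induced structure.
  have hDU : D ⊆ U := hU (ι p) p.2 (ι x) x.2 (ι y) y.2 ⟨hxp.symm, D, hD, hpD, hxD⟩
    ⟨hyp.symm, D, hD, hpD, hyD⟩ ⟨hxy, D, hD, hxD, hyD⟩ D hD hpD hxD hyD
  have himage : ι '' (ι ⁻¹' D) = D := Set.image_preimage_eq_of_subset (hDU.trans hrange.ge)
  have hD' : ι ⁻¹' D ∈ ((chainGeometry (algebraMap L S)).induced U).chains := by
    have : ι '' (ι ⁻¹' D) ∈ (chainGeometry (algebraMap L S)).chains := by rwa [himage]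
    exact this
  exact h.separated _ hD' hpD x hx (ne_of_apply_ne ι hxp) (ne_of_apply_ne ι hxq) hxD y hy
    (ne_of_apply_ne ι hyp) (ne_of_apply_ne ι hyq) hyD

end Algebra

/-! ### The cross in the geometry of `GF(4)` in the binary matrices -/

section BinaryMatrices

/-- A generator of the subfield of order four of `M(2×2,GF(2))`. -/
def singer : Matrix (Fin 2) (Fin 2) (ZMod 2) := !![0, 1; 1, 1]

/-- A unit outside the subfield of order four. -/
def flip : Matrix (Fin 2) (Fin 2) (ZMod 2) := !![0, 1; 1, 0]

theorem forall_matrix_iff {P : Matrix (Fin 2) (Fin 2) (ZMod 2) → Prop} :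
    (∀ x, P x) ↔ ∀ a b c d : ZMod 2, P !![a, b; c, d] :=
  ⟨fun h _ _ _ _ => h _, fun h x => by rw [Matrix.eta_fin_two x]; exact h _ _ _ _⟩

theorem eq_singer_or : ∀ x : Matrix (Fin 2) (Fin 2) (ZMod 2), x * x + x + 1 = 0 →
    x = singer ∨ x = singer + 1 := by
  rw [forall_matrix_iff]
  decide

/-- The six units split into the two cosets of the group of order 3 generated by `singer`. -/
theorem eq_of_det_ne_zero : ∀ x : Matrix (Fin 2) (Fin 2) (ZMod 2), x.det ≠ 0 →
    (x = 1 ∨ x = singer ∨ x = singer + 1) ∨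
    (x = flip ∨ x = singer * flip ∨ x = (singer + 1) * flip) := by
  rw [forall_matrix_iff]
  simp only [Matrix.det_fin_two_of]
  decide

variable (ι : GaloisField 2 2 →+* Matrix (Fin 2) (Fin 2) (ZMod 2))

theorem galoisField_four {k : GaloisField 2 2} (h0 : k ≠ 0) (h1 : k ≠ 1) : k * k + k + 1 = 0 := by
  have hcard : Nat.card (GaloisField 2 2) = 4 := GaloisField.card 2 2 two_ne_zero
  have : Fintype (GaloisField 2 2) := Fintype.ofFinite _
  have h3 : k ^ 3 = 1 := by
    have := FiniteField.pow_card_sub_one_eq_one k h0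
    rwa [← Nat.card_eq_fintype_card, hcard] at this
  have : (k - 1) * (k * k + k + 1) = 0 := by linear_combination h3
  exact (mul_eq_zero.1 this).resolve_left (sub_ne_zero.2 h1)

theorem map_eq_or (k : GaloisField 2 2) (hk : k ≠ 0) :
    ι k = 1 ∨ ι k = singer ∨ ι k = singer + 1 := by
  by_cases h1 : k = 1
  · simp [h1]
  · right
    apply eq_singer_or
    have := congrArg ι (galoisField_four hk h1)
    simpa using this

/-- The image of the embedding does not depend on `ι`: an element `k` outside the prime field goes
to one of the two roots of `x² + x + 1`, and `k + 1` goes to the other. -/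
theorem mem_range_of_eq {x : Matrix (Fin 2) (Fin 2) (ZMod 2)}
    (hx : x = 1 ∨ x = singer ∨ x = singer + 1) : ∃ k, k ≠ 0 ∧ ι k = x := by
  obtain ⟨k, h0, h1⟩ : ∃ k : GaloisField 2 2, k ≠ 0 ∧ k ≠ 1 := by
    by_contra! hall
    have hcard : Nat.card (GaloisField 2 2) = 4 := GaloisField.card 2 2 two_ne_zero
    have hle : (Set.univ : Set (GaloisField 2 2)).ncard ≤ ({0, 1} : Set (GaloisField 2 2)).ncard :=
      Set.ncard_le_ncard (fun k _ => by
        by_cases hk : k = 0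
        · simp [hk]
        · simp [hall k hk])
    rw [Set.ncard_univ, hcard, Set.ncard_pair zero_ne_one] at hle
    omega
  have hk1 : k + 1 ≠ 0 := by
    intro h
    exact h1 (by rw [eq_neg_of_add_eq_zero_left h, CharTwo.neg_eq])
  have hss : singer + 1 + 1 = singer := by decide
  have hk : ι k = singer ∨ ι k = singer + 1 := by
    apply eq_singer_or
    have := congrArg ι (galoisField_four h0 h1)
    simpa using this
  rcases hx with rfl | rfl | rfl
  · exact ⟨1, one_ne_zero, map_one ι⟩
  · rcases hk with hk | hk
    · exact ⟨k, h0, hk⟩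
    · exact ⟨k + 1, hk1, by rw [map_add, hk, map_one, hss]⟩
  · rcases hk with hk | hk
    · exact ⟨k + 1, hk1, by rw [map_add, hk, map_one]⟩
    · exact ⟨k, h0, hk⟩

/-- Conjugation preserves the equation `x² + x + 1 = 0`, and its only matrix solutions lie in the
subfield. -/
theorem isNormalized_galoisField : IsNormalized ι := by
  intro a k
  by_cases h0 : k = 0
  · exact ⟨0, by simp [h0]⟩
  by_cases h1 : k = 1
  · exact ⟨1, by simp [h1]⟩
  let b : Matrix (Fin 2) (Fin 2) (ZMod 2) := ↑a⁻¹
  have hab : ∀ x, a.1 * (b * x) = x := a.mul_inv_cancel_left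
  have hba : b * a.1 = 1 := a.inv_mul
  have hx : (b * ι k * a) * (b * ι k * a) + (b * ι k * a) + 1 = b * ι (k * k + k + 1) * a := by
    simp [mul_add, add_mul, mul_assoc, hab, hba]
  rw [galoisField_four h0 h1, map_zero, mul_zero, zero_mul] at hx
  obtain ⟨l, -, hl⟩ := mem_range_of_eq ι (Or.inr (eq_singer_or _ hx))
  exact ⟨l, hl.symm⟩

theorem affineChain_smul (k : GaloisField 2 2) (hk : k ≠ 0)
    (u : Matrix (Fin 2) (Fin 2) (ZMod 2)) : affineChain ι 0 (ι k * u) = affineChain ι 0 u := by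
  rw [affineChain, affineChain]
  congr 1
  ext p
  constructor
  · rintro ⟨l, rfl⟩
    exact ⟨l * k, by simp [mul_assoc]⟩
  · rintro ⟨l, rfl⟩
    exact ⟨l * k⁻¹, by simp only [← mul_assoc, ← map_mul, inv_mul_cancel_right₀ hk]⟩

theorem flip_mul_flip : flip * flip = 1 := by decide

/-- The unit `t = x⁻¹ * y * flip` lies outside the subgroup of order 3, so `t² = 1` and `(t - 1)² =
0` in characteristic 2. Thus `y * flip - x = x(t - 1)` is singular. -/
theorem det_sub_eq_zero {x y : Matrix (Fin 2) (Fin 2) (ZMod 2)}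
    (hx : x = 1 ∨ x = singer ∨ x = singer + 1) (hy : y = 1 ∨ y = singer ∨ y = singer + 1) :
    (y * flip - x).det = 0 := by
  rw [Matrix.det_fin_two]
  rcases hx with rfl | rfl | rfl <;> rcases hy with rfl | rfl | rfl <;> decide

theorem mul_flip_ne {x y : Matrix (Fin 2) (Fin 2) (ZMod 2)}
    (hx : x = 1 ∨ x = singer ∨ x = singer + 1) (hy : y = 1 ∨ y = singer ∨ y = singer + 1) :
    x ≠ y * flip := by
  rcases hx with rfl | rfl | rfl <;> rcases hy with rfl | rfl | rfl <;> decide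

/-- Chains through `∞` and `0` correspond to the cosets of `GF(4)*` in the unit group, and the index
is 2. -/
theorem eq_affineChain_one_or_flip {C : Set (Submodule (Matrix (Fin 2) (Fin 2) (ZMod 2)) _)}
    (hC : C ∈ chainSets ι) (h1 : infPoint _ ∈ C) (h0 : affinePoint 0 ∈ C) :
    C = affineChain ι 0 1 ∨ C = affineChain ι 0 flip := by
  obtain ⟨u, rfl⟩ := eq_affineChain_zero (isNormalized_galoisField ι) hC h1 h0
  have hu := ((Matrix.isUnit_iff_isUnit_det _).1 u.isUnit).ne_zero
  rcases eq_of_det_ne_zero _ hu with h | h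
  · obtain ⟨k, hk, hku⟩ := mem_range_of_eq ι h
    left
    rw [← hku, ← affineChain_smul ι k hk 1, mul_one]
  · have hx : (u : Matrix (Fin 2) (Fin 2) (ZMod 2)) * flip = 1 ∨
        (u : Matrix (Fin 2) (Fin 2) (ZMod 2)) * flip = singer ∨
        (u : Matrix (Fin 2) (Fin 2) (ZMod 2)) * flip = singer + 1 := by
      rcases h with h | h | h <;> simp [h, mul_assoc, flip_mul_flip]
    obtain ⟨k, hk, hku⟩ := mem_range_of_eq ι hx
    right
    rw [← affineChain_smul ι k hk flip, hku, mul_assoc, flip_mul_flip, mul_one]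

theorem encard_affineChain_one : (affineChain ι 0 1).encard = 5 := by
  have hinj : Function.Injective fun k => affinePoint (0 + ι k * 1) := fun k l h =>
    ι.injective (by simpa using affinePoint_injective h)
  rw [affineChain, Set.encard_insert_of_notMem, ← Set.image_univ, hinj.encard_image,
    Set.encard_univ, ENat.card_eq_coe_natCard, GaloisField.card 2 2 two_ne_zero]
  · norm_num
  · rintro ⟨k, hk⟩
    exact affinePoint_ne_infPoint _ hk

/-- The chain geometry of `GF(4)` in `M(2×2,GF(2))` has a cross whose points are joined by no
further chain. -/
theorem exists_isCross : ∃ p q C₁ C₂, IsCross (chainGeometry ι) p q C₁ C₂ ∧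
    (∀ D ∈ (chainGeometry ι).chains, p ∈ D → q ∈ D → D = C₁ ∨ D = C₂) ∧ C₁.encard = 5 := by
  let c : (Matrix (Fin 2) (Fin 2) (ZMod 2))ˣ := ⟨flip, flip, flip_mul_flip, flip_mul_flip⟩
  obtain ⟨C₁, hC₁, h₁⟩ := exists_chain (affineChain_mem_chainSets ι 0 1)
  obtain ⟨C₂, hC₂, h₂⟩ := exists_chain (affineChain_mem_chainSets ι 0 c)
  have zero_mem (u) : affinePoint 0 ∈ affineChain ι 0 u :=
    affinePoint_mem_affineChain.2 ⟨0, by simp⟩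
  have hinf := infPoint_mem_affineChain ι 0 1
  have hzero := zero_mem 1
  rw [Units.val_one] at h₁
  rw [← h₁] at hinf hzero
  obtain ⟨p, hp, hpv⟩ := hinf
  obtain ⟨q, hq, hqv⟩ := hzero
  have mem_iff (z) (C : Set (chainGeometry ι).Point) : z ∈ C ↔ pointVal ι z ∈ pointVal ι '' C :=
    (pointVal_injective ι).mem_set_image.symm
  refine ⟨p, q, C₁, C₂, ⟨?_, hC₁, hC₂, ⟨hp, hq⟩, ⟨?_, ?_⟩, ?_⟩, ?_, ?_⟩
  · rintro rfl
    exact affinePoint_ne_infPoint _ (hqv.symm.trans hpv)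
  · rw [mem_iff, h₂, hpv]
    exact infPoint_mem_affineChain _ _ _
  · rw [mem_iff, h₂, hqv]
    exact zero_mem _
  · intro D hD hpD x hx hxp hxq hxD y hy hyp hyq hyD
    rw [← (pointVal_injective ι).ne_iff, hpv] at hxp hyp
    rw [← (pointVal_injective ι).ne_iff, hqv] at hxq hyq
    rw [mem_iff] at hpD hxD hyD hx hy
    rw [hpv] at hpD
    rw [h₁] at hx
    rw [h₂] at hy
    obtain ⟨k, hk⟩ := hx.resolve_left hxp
    obtain ⟨l, hl⟩ := hy.resolve_left hyp
    have hk0 : k ≠ 0 := by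
      rintro rfl
      exact hxq (by rw [← hk]; simp)
    have hl0 : l ≠ 0 := by
      rintro rfl
      exact hyq (by rw [← hl]; simp)
    simp only [zero_add, mul_one] at hk hl
    rw [← hk] at hxD
    rw [← hl] at hyD
    -- A chain through `∞` meeting both lines would make the difference of the two points a unit,
    -- but it has determinant 0.
    have hunit := isUnit_sub_of_mem_chain (isNormalized_galoisField ι) (mem_chains_iff.1 hD) hpD
      hxD hyD (mul_flip_ne (map_eq_or ι k hk0) (map_eq_or ι l hl0))
    exact ((Matrix.isUnit_iff_isUnit_det _).1 hunit).ne_zero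
      (det_sub_eq_zero (map_eq_or ι k hk0) (map_eq_or ι l hl0))
  · intro D hD hpD hqD
    rw [mem_iff, hpv] at hpD
    rw [mem_iff, hqv] at hqD
    refine (eq_affineChain_one_or_flip ι (mem_chains_iff.1 hD) hpD hqD).imp ?_ ?_
    · exact fun h => (pointVal_injective ι).image_injective (h.trans h₁.symm)
    · exact fun h => (pointVal_injective ι).image_injective (h.trans h₂.symm)
  · rw [← (pointVal_injective ι).encard_image, h₁, encard_affineChain_one]

end BinaryMatrices

end ChainGeometry

/-! ### The main theorem -/

open ChainGeometry

theorem mainTheorem6 (ι : GaloisField 2 2 →+* Matrix (Fin 2) (Fin 2) (ZMod 2)) :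
    (∀ (L : Type*) (S : Type*) [Field L] [Ring S] [Nontrivial S] [Algebra L S],
      ¬ Nonempty (ChainStructure.Iso (chainGeometry ι) (chainGeometry (algebraMap L S)))) ∧
    (∀ (L : Type*) (S : Type*) [Field L] [Ring S] [Nontrivial S] [Algebra L S],
      IsStrongAlgebra L S →
        ¬ ChainStructure.EmbedsAsSubspace (chainGeometry ι) (chainGeometry (algebraMap L S))) := by
  obtain ⟨p, q, C₁, C₂, hcross, honly, hcard⟩ := exists_isCross ι
  constructor
  · rintro L S _ _ _ _ ⟨f⟩
    have hle := encard_le_of_isCross (hcross.map f) (by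
      intro D hD hp hq
      obtain ⟨D, rfl⟩ := f.toEquiv.surjective.image_surjective D
      rw [f.map_chains] at hD
      rw [f.toEquiv.injective.mem_set_image] at hp hq
      exact (honly D hD hp hq).imp (congrArg _) (congrArg _))
    rw [f.toEquiv.injective.encard_image, hcard] at hle
    exact absurd hle (by decide)
  · rintro L S _ _ _ _ hS ⟨U, hU, ⟨f⟩⟩
    exact not_isCross_induced hS hU (hcross.map f)
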